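/- Let $\{0,\dots,35\}$ carry the discrete topology and let $\mathbb Z^2$ act on the compact space $\{0,\dots,35\}^{\mathbb Z^2}$ by the left shift $(sx)_t=x_{t-s}$. A subshift is a closed shift-invariant subset of $\{0,\dots,35\}^{\mathbb Z^2}$; the set of all subshifts carries the Vietoris topology and the associated Borel $\sigma$-algebra. A function $x:\mathbb Z^2\to\{0,\dots,35\}$ is Toeplitz if it is continuous for the topology on $\mathbb Z^2$ generated by all cosets of finite index subgroups, and a subshift is Toeplitz if it is the closure of the $\mathbb Z^2$-orbit of a Toeplitz function. The topological full group $[[\mathbb Z^2\curvearrowright X]]$ of a subshift $X$ is the group of all homeomorphisms $T:X\to X$ for which there are a finite clopen partition $\{A_1,\dots,A_n\}$ of $X$ and $s_1,\dots,s_n\in\mathbb Z^2$ with $Tx=s_ix$ for all $i$ and all $x\in A_i$. Let $\mathrm{NAToepSubsh}(36^{\mathbb Z^2})$ be the space (with the subspace Borel structure) of all Toeplitz subshifts $X$ on which $\mathbb Z^2$ acts freely and whose topological full group $[[\mathbb Z^2\curvearrowright X]]$ is nonamenable (as a discrete group). Two subshifts $X,Y$ are continuously orbit equivalent if there are a homeomorphism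 $\Phi:X\to Y$ and continuous maps $\kappa:\mathbb Z^2\times X\to\mathbb Z^2$ and $\lambda:\mathbb Z^2\times Y\to\mathbb Z^2$ such that $\Phi(sx)=\kappa(s,x)\Phi(x)$ and $\Phi^{-1}(ty)=\lambda(t,y)\Phi^{-1}(y)$ for all $s,t\in\mathbb Z^2$, $x\in X$, $y\in Y$. Then the relation of continuous orbit equivalence on $\mathrm{NAToepSubsh}(36^{\mathbb Z^2})$ is not smooth: there are no standard Borel space $Z$ and Borel map $\varphi:\mathrm{NAToepSubsh}(36^{\mathbb Z^2})\to Z$ such that, for all $X,Y\in\mathrm{NAToepSubsh}(36^{\mathbb Z^2})$, the subshifts $X$ and $Y$ are continuously orbit equivalent if and only if $\varphi(X)=\varphi(Y)$. -/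

import Mathlib

open Set Topology SymbolicDynamics.FullShift

/-! ### Continuous orbit equivalence -/

/-- Two actions `G ↷ X` and `H ↷ Y` (written additively) are continuously orbit equivalent. -/
def ContOrbitEquiv (G X H Y : Type*) [AddGroup G] [TopologicalSpace G] [TopologicalSpace X]
    [AddAction G X] [AddGroup H] [TopologicalSpace H] [TopologicalSpace Y] [AddAction H Y] : Prop :=
  ∃ (Φ : X ≃ₜ Y) (κ : C(G × X, H)) (l : C(H × Y, G)),
    (∀ (s : G) (x : X), Φ (s +ᵥ x) = κ (s, x) +ᵥ Φ x) ∧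
    (∀ (t : H) (y : Y), Φ.symm (t +ᵥ y) = l (t, y) +ᵥ Φ.symm y)

section ContOrbitEquiv

variable {G X H Y K Z : Type*} [AddGroup G] [TopologicalSpace G] [TopologicalSpace X]
  [AddAction G X] [AddGroup H] [TopologicalSpace H] [TopologicalSpace Y] [AddAction H Y]
  [AddGroup K] [TopologicalSpace K] [TopologicalSpace Z] [AddAction K Z]

theorem ContOrbitEquiv.refl' : ContOrbitEquiv G X G X :=
  ⟨Homeomorph.refl X, ⟨Prod.fst, continuous_fst⟩, ⟨Prod.fst, continuous_fst⟩,
    fun _ _ => rfl, fun _ _ => rfl⟩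

theorem ContOrbitEquiv.symm' (h : ContOrbitEquiv G X H Y) : ContOrbitEquiv H Y G X := by
  obtain ⟨Φ, κ, l, h₁, h₂⟩ := h
  exact ⟨Φ.symm, l, κ, h₂, h₁⟩

theorem ContOrbitEquiv.trans' (h : ContOrbitEquiv G X H Y) (h' : ContOrbitEquiv H Y K Z) :
    ContOrbitEquiv G X K Z := by
  obtain ⟨Φ, κ, l, h₁, h₂⟩ := h
  obtain ⟨Φ', κ', l', h₁', h₂'⟩ := h'
  refine ⟨Φ.trans Φ', ⟨fun p => κ' (κ p, Φ p.2), by fun_prop⟩,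
    ⟨fun p => l (l' p, Φ'.symm p.2), by fun_prop⟩, fun s x => ?_, fun t z => ?_⟩
  · simp [h₁, h₁']
  · simp [h₂, h₂']

end ContOrbitEquiv

/-! ### Topological full groups and amenability -/

/-- `T` is given on each piece of a finite clopen partition of `X` by an element of `G`. -/
def IsPiecewiseAction (G : Type*) {X : Type*} [AddGroup G] [TopologicalSpace X] [AddAction G X]
    (T : X ≃ₜ X) : Prop :=
  ∃ (n : ℕ) (A : Fin n → Set X) (s : Fin n → G),
    (∀ i, IsClopen (A i)) ∧ Pairwise (fun i j => Disjoint (A i) (A j)) ∧ (⋃ i, A i) = univ ∧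
      ∀ i, ∀ x ∈ A i, T x = s i +ᵥ x

theorem IsPiecewiseAction.of_finite {G X ι : Type*} [AddGroup G] [TopologicalSpace X]
    [AddAction G X] [Finite ι] {T : X ≃ₜ X} (A : ι → Set X) (s : ι → G)
    (hc : ∀ i, IsClopen (A i)) (hd : Pairwise (fun i j => Disjoint (A i) (A j)))
    (hu : (⋃ i, A i) = univ) (hT : ∀ i, ∀ x ∈ A i, T x = s i +ᵥ x) : IsPiecewiseAction G T := by
  obtain ⟨n, ⟨e⟩⟩ := Finite.exists_equiv_fin ι
  refine ⟨n, fun i => A (e.symm i), fun i => s (e.symm i), fun i => hc _,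
    fun i j hij => hd (e.symm.injective.ne hij), ?_, fun i x hx => hT _ x hx⟩
  rw [← hu]
  exact e.symm.surjective.iUnion_comp A

/-- The topological full group of the action `G ↷ X`. -/
def topologicalFullGroup (G X : Type*) [AddGroup G] [TopologicalSpace X] [AddAction G X] :
    Subgroup (X ≃ₜ X) where
  carrier := {T | IsPiecewiseAction G T}
  one_mem' := .of_finite (ι := Unit) (fun _ => univ) (fun _ => 0) (fun _ => isClopen_univ)
    (fun i j h => (h (Subsingleton.elim i j)).elim) (iUnion_const _)
    (fun _ x _ => (zero_vadd G x).symm)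
  mul_mem' := by
    rintro S T ⟨m, B, t, hBc, hBd, hBu, hS⟩ ⟨n, A, s, hAc, hAd, hAu, hT⟩
    refine .of_finite (ι := Fin m × Fin n) (fun p => A p.2 ∩ T ⁻¹' B p.1)
      (fun p => t p.1 + s p.2) (fun p => (hAc _).inter ((hBc _).preimage T.continuous)) ?_ ?_ ?_
    · rintro ⟨i, j⟩ ⟨i', j'⟩ h
      by_cases hj : j = j'
      · have hi : i ≠ i' := fun hi => h (by rw [hi, hj])
        exact ((hBd hi).preimage T).mono inter_subset_right inter_subset_right
      · exact (hAd hj).mono inter_subset_left inter_subset_left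
    · refine eq_univ_of_forall fun x => ?_
      obtain ⟨j, hj⟩ := mem_iUnion.1 (hAu.symm ▸ mem_univ x : x ∈ ⋃ i, A i)
      obtain ⟨i, hi⟩ := mem_iUnion.1 (hBu.symm ▸ mem_univ (T x) : T x ∈ ⋃ i, B i)
      exact mem_iUnion.2 ⟨(i, j), hj, hi⟩
    · rintro ⟨i, j⟩ x ⟨hj, hi⟩
      rw [Homeomorph.mul_apply, hS i _ hi, hT j x hj, add_vadd]
  inv_mem' := by
    rintro T ⟨n, A, s, hAc, hAd, hAu, hT⟩
    refine .of_finite (fun i => T.symm ⁻¹' A i) (fun i => - s i)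
      (fun i => (hAc i).preimage T.symm.continuous) (fun i j h => (hAd h).preimage T.symm) ?_ ?_
    · rw [← preimage_iUnion, hAu, preimage_univ]
    · intro i y hy
      have h := hT i _ hy
      rw [T.apply_symm_apply] at h
      change T.symm y = _
      rw [eq_neg_vadd_iff, ← h]

/-- Amenability of a discrete group: there is a left invariant finitely additive probability
measure defined on all subsets. -/
def IsAmenableGroup (G : Type*) [Group G] : Prop :=
  ∃ m : Set G → ℝ, (∀ A, 0 ≤ m A) ∧ m univ = 1 ∧
    (∀ A B, Disjoint A B → m (A ∪ B) = m A + m B) ∧ ∀ (g : G) (A : Set G), m ((g * ·) '' A) = m A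

/-! ### The space of subshifts -/

section Subshift

variable {A G : Type*} [TopologicalSpace A] [AddGroup G]

/-- The left shift action `(s +ᵥ x) t = x (-s + t)` on the points of a subshift. -/
instance subshiftAddAction (X : Subshift A G) : AddAction G X.carrier where
  vadd s x := ⟨shift (-s) x.1, X.mapsTo (-s) x.2⟩
  zero_vadd x := Subtype.ext (by funext t; change x.1 (-0 + t) = x.1 t; simp)
  add_vadd r s x := Subtype.ext (by
    funext t
    change x.1 (-(r + s) + t) = x.1 (-s + (-r + t))
    rw [neg_add_rev, add_assoc])

theorem subshift_vadd_apply (X : Subshift A G) (s : G) (x : X.carrier) (t : G) :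
    (s +ᵥ x).1 t = x.1 (-s + t) := rfl

/-- The Vietoris topology on the space of subshifts. -/
instance subshiftTopology : TopologicalSpace (Subshift A G) :=
  .induced Subshift.carrier (TopologicalSpace.vietoris (G → A))

instance subshiftMeasurableSpace : MeasurableSpace (Subshift A G) := borel _

instance subshiftBorelSpace : BorelSpace (Subshift A G) := ⟨rfl⟩

/-- The shift action on `X` is free. -/
def IsFreeSubshift (X : Subshift A G) : Prop :=
  ∀ (s : G) (x : X.carrier), s +ᵥ x = x → s = 0

/-- The topology on `G` generated by all cosets of finite index subgroups. -/
@[reducible]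
def profiniteTopology (G : Type*) [AddGroup G] : TopologicalSpace G :=
  .generateFrom {U | ∃ (H : AddSubgroup G) (g : G), H.FiniteIndex ∧ U = (g + ·) '' (H : Set G)}

/-- A Toeplitz function: it is continuous for the profinite topology on `G`. -/
def IsToeplitzFunction (x : G → A) : Prop :=
  @Continuous G A (profiniteTopology G) _ x

/-- A Toeplitz subshift: the orbit closure of a Toeplitz function. -/
def IsToeplitzSubshift (X : Subshift A G) : Prop :=
  ∃ x : G → A, IsToeplitzFunction x ∧ X.carrier = closure (range fun s : G => shift (-s) x)

end Subshift

/-- The free Toeplitz `ℤ²`-subshifts on `n` symbols whose topological full group is nonamenable. -/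
def NAToepSubsh (n : ℕ) : Set (Subshift (Fin n) (ℤ × ℤ)) :=
  {X | IsToeplitzSubshift X ∧ IsFreeSubshift X ∧
    ¬ IsAmenableGroup (topologicalFullGroup (ℤ × ℤ) X.carrier)}

/-- Continuous orbit equivalence, as an equivalence relation on `NAToepSubsh n`. -/
def coeSetoid (n : ℕ) : Setoid (NAToepSubsh n) where
  r X Y := ContOrbitEquiv (ℤ × ℤ) X.1.carrier (ℤ × ℤ) Y.1.carrier
  iseqv := ⟨fun _ => .refl', .symm', .trans'⟩

/-! ### Smoothness -/

/-- An equivalence relation is smooth if some Borel map to a standard Borel space is a complete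
invariant for it. (Every standard Borel space is Borel isomorphic to one in `Type`.) -/
def IsSmoothEquivRel {X : Type*} [MeasurableSpace X] (E : Setoid X) : Prop :=
  ∃ (Y : Type) (_ : MeasurableSpace Y) (_ : StandardBorelSpace Y) (φ : X → Y),
    Measurable φ ∧ ∀ x₁ x₂, E x₁ x₂ ↔ φ x₁ = φ x₂

/-! ### Amenability -/

/-! Each parameter p in the Cantor group (ℤ/2)^ℕ gives a Toeplitz configuration `config p` whose row
j repeats the word with number `level j` and carries the bit `digit j + p (level j)`; let X_p be its
orbit closure. The words make the full group nonamenable: every reduced word in three letters fills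
some row, so the swaps along edges with a given letter are three involutions that generate a free
product of three groups of order two.

The bits encode p. Windows of bits determine positions modulo powers of 3 (`pow_dvd_sub_of_bit_eq`).
Hence p ↦ X_p is injective, and changing p at one place is a local rule, so that X_p and X_q are
conjugate if p and q differ at finitely many places (`contOrbitEquiv_config_add_single`). Moreover p
↦ X_p is continuous (`continuous_orbitClosure_config`).

A Borel complete invariant would therefore pull back to a Borel function of p that is invariant
under a dense set of translations. By ergodicity of Haar measure it is constant almost everywhere,
so one fibre is uncountable. But continuous orbit equivalence classes are countable
(`countable_contOrbitEquiv`). -/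

theorem IsAmenableGroup.of_injective {G H : Type*} [Group G] [Group H] (hG : IsAmenableGroup G)
    (ψ : H →* G) (hψ : Function.Injective ψ) : IsAmenableGroup H := by
  obtain ⟨m, h0, h1, hadd, hinv⟩ := hG
  -- Representatives of the right cosets of the image of H give an H-equivariant map G → H, along
  -- which the mean is pushed forward.
  obtain ⟨f, hf⟩ : ∃ f : G → H, ∀ h g, f (ψ h * g) = h * f g := by
    let r : Setoid G := QuotientGroup.rightRel ψ.range
    have hr : ∀ g : G, ∃ h : H, ψ h * (Quotient.mk r g).out = g := by
      intro g
      have : r (Quotient.mk r g).out g := Quotient.exact (Quotient.out_eq _)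
      obtain ⟨h, hh⟩ := QuotientGroup.rightRel_apply.1 this
      exact ⟨h, by rw [hh]; group⟩
    choose f hf using hr
    refine ⟨f, fun h g => hψ ?_⟩
    have hq : Quotient.mk r (ψ h * g) = Quotient.mk r g :=
      Quotient.sound (QuotientGroup.rightRel_apply.2 ⟨h⁻¹, by simp⟩)
    have h1 := hf (ψ h * g)
    rw [hq] at h1
    rw [map_mul]
    apply mul_right_cancel (b := (Quotient.mk r g).out)
    rw [h1, mul_assoc, hf g]
  refine ⟨fun A => m (f ⁻¹' A), fun A => h0 _, h1, fun A B h => ?_, fun g A => ?_⟩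
  · exact hadd _ _ (h.preimage f)
  · refine Eq.trans ?_ (hinv (ψ g) _)
    refine congrArg m (Set.ext fun x => ?_)
    simp only [image_mul_left, mem_preimage, ← map_inv, hf]

/-- The free product of three groups of order two. -/
abbrev TripleFreeProduct : Type :=
  Monoid.CoprodI fun _ : Fin 3 => Multiplicative (ZMod 2)

theorem eq_ofAdd_one_of_ne_one {m : Multiplicative (ZMod 2)} (hm : m ≠ 1) :
    m = Multiplicative.ofAdd 1 := by
  revert m; decide

/-- Let S i be the set of reduced words that begin in the i-th factor. The i-th generator maps the
complement of S i into S i, so S i has mean at least 1/2; three disjoint such sets are too many. -/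
theorem not_isAmenableGroup_tripleFreeProduct : ¬ IsAmenableGroup TripleFreeProduct := by
  classical
  rintro ⟨m, h0, h1, hadd, hinv⟩
  let S : Fin 3 → Set TripleFreeProduct :=
    fun i => {h | (Monoid.CoprodI.Word.equiv h).fstIdx = some i}
  have hdisj : ∀ i j, i ≠ j → Disjoint (S i) (S j) := fun i j hij =>
    Set.disjoint_left.2 fun h (hi : _ = _) (hj : _ = _) => hij (by simpa [hi] using hj)
  have hmono : ∀ A B : Set TripleFreeProduct, A ⊆ B → m A ≤ m B := fun A B h => by
    have := hadd A (B \ A) disjoint_sdiff_right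
    rw [union_sdiff_cancel h] at this
    linarith [h0 (B \ A)]
  have hhalf : ∀ i, 1 ≤ 2 * m (S i) := fun i => by
    have h2 := hadd (S i) (S i)ᶜ disjoint_compl_right
    rw [union_compl_self, h1] at h2
    have h3 : m (S i)ᶜ ≤ m (S i) := by
      rw [← hinv (Monoid.CoprodI.of (i := i) (Multiplicative.ofAdd 1)) (S i)ᶜ]
      refine hmono _ _ ?_
      rintro _ ⟨h, hh, rfl⟩
      obtain ⟨w, rfl⟩ := Monoid.CoprodI.Word.equiv.symm.surjective h
      have hw : w.fstIdx ≠ some i := by simpa [S] using hh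
      have hne : (Multiplicative.ofAdd 1 : Multiplicative (ZMod 2)) ≠ 1 := by decide
      have : Monoid.CoprodI.of (i := i) (Multiplicative.ofAdd 1) *
          Monoid.CoprodI.Word.equiv.symm w = Monoid.CoprodI.Word.equiv.symm
            (Monoid.CoprodI.Word.cons (M := fun _ : Fin 3 => Multiplicative (ZMod 2))
              (Multiplicative.ofAdd 1) w hw hne) :=
        (Monoid.CoprodI.Word.prod_cons i _ w hne hw).symm
      simp only [S, mem_ofPred_eq, this, Equiv.apply_symm_apply,
        Monoid.CoprodI.Word.fstIdx_cons]
    linarith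
  have h01 := hadd (S 0) (S 1) (hdisj _ _ (by decide))
  have h012 := hadd (S 0 ∪ S 1) (S 2)
    (disjoint_union_left.2 ⟨hdisj _ _ (by decide), hdisj _ _ (by decide)⟩)
  have hle := hmono (S 0 ∪ S 1 ∪ S 2) univ (subset_univ _)
  linarith [hhalf 0, hhalf 1, hhalf 2]

/-- A group with three involutions, no nonempty reduced word in which is trivial, is not
amenable. -/
theorem not_isAmenableGroup_of_involutions {G : Type*} [Group G] (a : Fin 3 → G)
    (ha : ∀ i, a i * a i = 1)
    (hw : ∀ l : List (Fin 3), l ≠ [] → l.IsChain (· ≠ ·) → (l.map a).prod ≠ 1) :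
    ¬ IsAmenableGroup G := by
  classical
  let φ : ∀ _ : Fin 3, Multiplicative (ZMod 2) →* G := fun i =>
    MonoidHom.mk' (fun x => a i ^ (Multiplicative.toAdd x).val) (by
      change ∀ x y : ZMod 2, a i ^ (x + y).val = a i ^ x.val * a i ^ y.val
      intro x y
      rw [ZMod.val_add, ← pow_add, ← pow_eq_pow_mod _ ((pow_two _).trans (ha i))])
  have hφ : ∀ i, φ i (Multiplicative.ofAdd 1) = a i := fun i => pow_one (a i)
  refine fun hG => not_isAmenableGroup_tripleFreeProduct
    (hG.of_injective (Monoid.CoprodI.lift φ) ?_)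
  rw [injective_iff_map_eq_one]
  intro h hh
  obtain ⟨w, rfl⟩ := Monoid.CoprodI.Word.equiv.symm.surjective h
  by_contra hne
  refine hw (w.toList.map Sigma.fst) (fun h => hne ?_) ?_ ?_
  · have : w = Monoid.CoprodI.Word.empty := Monoid.CoprodI.Word.ext (List.map_eq_nil_iff.1 h)
    rw [this]; exact Monoid.CoprodI.Word.prod_empty
  · rw [List.isChain_map]
    exact w.chain_ne
  · rw [← hh]
    change _ = Monoid.CoprodI.lift φ w.prod
    rw [Monoid.CoprodI.Word.prod, map_list_prod, List.map_map, List.map_map]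
    congr 1
    refine List.map_congr_left fun p hp => ?_
    have := eq_ofAdd_one_of_ne_one (w.ne_one p hp)
    simp [← hφ, ← this]

/-! ### Ternary digits -/

/-- The number of initial ternary digits of `j` equal to `1`, and a label (`0` or `1`) for the first
digit that is different from `1`. -/
def ternaryData (j : ℤ) : ℕ × ZMod 2 :=
  if j % 3 = 0 then (0, 0)
  else if j % 3 = 2 then (0, 1)
  else ((ternaryData (j / 3)).1 + 1, (ternaryData (j / 3)).2)
-- An infinite string of digits 1 is the 3-adic number -1/2, which is not an integer, so every level
-- is finite.
termination_by j.natAbs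
decreasing_by all_goals omega

/-- The number of initial ternary digits of `j` that are equal to `1`. -/
def level (j : ℤ) : ℕ := (ternaryData j).1

/-- The label of the first ternary digit of `j` that is different from `1`. -/
def digit (j : ℤ) : ZMod 2 := (ternaryData j).2

theorem level_three_mul (k : ℤ) : level (3 * k) = 0 := by
  rw [level, ternaryData, if_pos (by omega)]

theorem digit_three_mul (k : ℤ) : digit (3 * k) = 0 := by
  rw [digit, ternaryData, if_pos (by omega)]

theorem level_three_mul_add_two (k : ℤ) : level (3 * k + 2) = 0 := by
  rw [level, ternaryData, if_neg (by omega), if_pos (by omega)]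

theorem digit_three_mul_add_two (k : ℤ) : digit (3 * k + 2) = 1 := by
  rw [digit, ternaryData, if_neg (by omega), if_pos (by omega)]

theorem level_three_mul_add_one (k : ℤ) : level (3 * k + 1) = level k + 1 := by
  rw [level, ternaryData, if_neg (by omega), if_neg (by omega),
    show (3 * k + 1) / 3 = k by omega, level]

theorem digit_three_mul_add_one (k : ℤ) : digit (3 * k + 1) = digit k := by
  rw [digit, ternaryData, if_neg (by omega), if_neg (by omega),
    show (3 * k + 1) / 3 = k by omega, digit]

theorem exists_eq_three_mul_add (j : ℤ) :
    (∃ k, j = 3 * k) ∨ (∃ k, j = 3 * k + 1) ∨ ∃ k, j = 3 * k + 2 := by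
  rcases (by omega : j % 3 = 0 ∨ j % 3 = 1 ∨ j % 3 = 2) with h | h | h
  · exact .inl ⟨j / 3, by omega⟩
  · exact .inr (.inl ⟨j / 3, by omega⟩)
  · exact .inr (.inr ⟨j / 3, by omega⟩)

theorem exists_level_eq (n : ℕ) : ∃ j, level j = n := by
  induction n with
  | zero => exact ⟨_, level_three_mul 0⟩
  | succ n ih =>
    obtain ⟨j, hj⟩ := ih
    exact ⟨3 * j + 1, by rw [level_three_mul_add_one, hj]⟩

/-- Adding multiples of `3 ^ n` changes neither the level nor the digit of integers of level less
than `n`. -/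
theorem level_digit_add_of_level_lt {n : ℕ} {j : ℤ} (h : level j < n) (k : ℤ) :
    level (j + 3 ^ n * k) = level j ∧ digit (j + 3 ^ n * k) = digit j := by
  induction n generalizing j with
  | zero => omega
  | succ n ih =>
    obtain ⟨u, rfl⟩ | ⟨u, rfl⟩ | ⟨u, rfl⟩ := exists_eq_three_mul_add j
    · rw [show 3 * u + 3 ^ (n + 1) * k = 3 * (u + 3 ^ n * k) by ring]
      simp only [level_three_mul, digit_three_mul, and_self]
    · rw [show 3 * u + 1 + 3 ^ (n + 1) * k = 3 * (u + 3 ^ n * k) + 1 by ring]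
      simp only [level_three_mul_add_one, digit_three_mul_add_one] at h ⊢
      have := ih (j := u) (by omega)
      exact ⟨by rw [this.1], this.2⟩
    · rw [show 3 * u + 2 + 3 ^ (n + 1) * k = 3 * (u + 3 ^ n * k) + 2 by ring]
      simp only [level_three_mul_add_two, digit_three_mul_add_two, and_self]

/-- The digit of an integer of level `n` is changed by adding some multiple of `3 ^ n` without
changing the level. -/
theorem exists_digit_swap (j : ℤ) :
    ∃ k, level (j + 3 ^ level j * k) = level j ∧ digit (j + 3 ^ level j * k) = digit j + 1 := by
  generalize hn : level j = n
  induction n generalizing j with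
  | zero =>
    obtain ⟨u, rfl⟩ | ⟨u, rfl⟩ | ⟨u, rfl⟩ := exists_eq_three_mul_add j
    · refine ⟨2, ?_⟩
      rw [show 3 * u + 3 ^ 0 * 2 = 3 * u + 2 by ring, level_three_mul_add_two,
        digit_three_mul_add_two, digit_three_mul]
      exact ⟨rfl, rfl⟩
    · simp [level_three_mul_add_one] at hn
    · refine ⟨-2, ?_⟩
      rw [show 3 * u + 2 + 3 ^ 0 * -2 = 3 * u by ring, level_three_mul,
        digit_three_mul_add_two, digit_three_mul]
      exact ⟨rfl, rfl⟩
  | succ n ih =>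
    obtain ⟨u, rfl⟩ | ⟨u, rfl⟩ | ⟨u, rfl⟩ := exists_eq_three_mul_add j
    · simp [level_three_mul] at hn
    · rw [level_three_mul_add_one] at hn
      obtain ⟨k, hk⟩ := ih u (by omega)
      refine ⟨k, ?_⟩
      rw [show 3 * u + 1 + 3 ^ (n + 1) * k = 3 * (u + 3 ^ n * k) + 1 by ring]
      simpa only [level_three_mul_add_one, digit_three_mul_add_one, add_left_inj] using hk
    · simp [level_three_mul_add_two] at hn

/-- The n lowest digits are all 1, which fixes the residue modulo 3 ^ n. -/
theorem pow_dvd_sub_of_le_level {n : ℕ} {i j : ℤ} (hi : n ≤ level i) (hj : n ≤ level j) :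
    (3 : ℤ) ^ n ∣ i - j := by
  induction n generalizing i j with
  | zero => simp
  | succ n ih =>
    obtain ⟨u, rfl⟩ | ⟨u, rfl⟩ | ⟨u, rfl⟩ := exists_eq_three_mul_add i
    · simp [level_three_mul] at hi
    · obtain ⟨v, rfl⟩ | ⟨v, rfl⟩ | ⟨v, rfl⟩ := exists_eq_three_mul_add j
      · simp [level_three_mul] at hj
      · simp only [level_three_mul_add_one, add_le_add_iff_right] at hi hj
        rw [show 3 * u + 1 - (3 * v + 1) = 3 * (u - v) by ring, pow_succ']
        exact mul_dvd_mul_left _ (ih hi hj)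
      · simp [level_three_mul_add_two] at hj
    · simp [level_three_mul_add_two] at hi

theorem level_digit_congr {n : ℕ} {i j : ℤ} (h : level i < n) (hij : (3 : ℤ) ^ n ∣ i - j) :
    level j = level i ∧ digit j = digit i := by
  obtain ⟨k, hk⟩ := hij
  have := level_digit_add_of_level_lt h (-k)
  rwa [show i + 3 ^ n * -k = j by linarith] at this

theorem level_eq_iff_of_dvd {n : ℕ} {i j : ℤ} (hij : (3 : ℤ) ^ (n + 1) ∣ i - j) :
    level i = n ↔ level j = n := by
  constructor <;> intro h
  · rw [(level_digit_congr (by omega) hij).1, h]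
  · rw [(level_digit_congr (by omega) ((dvd_sub_comm).1 hij)).1, h]

/-- Every interval of length `3 ^ (n + 1)` contains an integer of level `n`. -/
theorem exists_level_add_eq (n : ℕ) (j : ℤ) : ∃ t : ℤ, 0 ≤ t ∧ t < 3 ^ (n + 1) ∧
    level (j + t) = n := by
  obtain ⟨c, hc⟩ := exists_level_eq n
  refine ⟨(c - j) % 3 ^ (n + 1), Int.emod_nonneg _ (by positivity),
    Int.emod_lt_of_pos _ (by positivity), ?_⟩
  refine (level_eq_iff_of_dvd (i := c) ?_).1 hc
  have := Int.emod_add_mul_ediv (c - j) (3 ^ (n + 1))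
  exact ⟨(c - j) / 3 ^ (n + 1), by linarith⟩

/-! ### Recognizability -/

/-- The digit sequence, modified on the integers of level `n` according to `p n`. -/
def bit (p : ℕ → ZMod 2) (j : ℤ) : ZMod 2 := digit j + p (level j)

theorem bit_three_mul (p : ℕ → ZMod 2) (k : ℤ) : bit p (3 * k) = p 0 := by
  rw [bit, digit_three_mul, level_three_mul, zero_add]

theorem bit_three_mul_add_two (p : ℕ → ZMod 2) (k : ℤ) : bit p (3 * k + 2) = 1 + p 0 := by
  rw [bit, digit_three_mul_add_two, level_three_mul_add_two]

theorem bit_three_mul_add_one (p : ℕ → ZMod 2) (k : ℤ) :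
    bit p (3 * k + 1) = bit (fun n => p (n + 1)) k := by
  rw [bit, digit_three_mul_add_one, level_three_mul_add_one, bit]

/-- Multiples of 3 and their translates by 2 carry opposite bits. A multiple of 3 occurs among the
first three positions, whence the length 5. -/
theorem exists_bit_ne (p : ℕ → ZMod 2) (k : ℤ) :
    ∃ t : ℤ, 0 ≤ t ∧ t < 5 ∧ ∃ t', 0 ≤ t' ∧ t' < 5 ∧ bit p (k + t) ≠ bit p (k + t') := by
  refine ⟨(-k) % 3, by omega, by omega, (-k) % 3 + 2, by omega, by omega, ?_⟩
  obtain ⟨u, hu⟩ : ∃ u, k + (-k) % 3 = 3 * u := ⟨(k + (-k) % 3) / 3, by omega⟩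
  rw [← add_assoc, hu, bit_three_mul, bit_three_mul_add_two]
  generalize p 0 = a
  revert a; decide

/-- The length of the windows of the bit sequence that determine a position modulo `3 ^ n`. -/
def windowLength : ℕ → ℕ
  | 0 => 0
  -- The inductive step reads every third position after an offset of at most 2; the constant 25
  -- leaves room for that offset and the 20 positions that settle the residue modulo 3.
  | n + 1 => 3 * windowLength n + 25

/-- The bits are constant on the residue classes 0 and 2 modulo 3, while on the class 1 they form a
nonconstant sequence of the same kind with shifted parameter. This singles out the class 1, and
induction applies to it. Different parameters p and q are allowed, so the position is read off
without knowing the parameter. -/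
theorem pow_dvd_sub_of_bit_eq (n : ℕ) {p q : ℕ → ZMod 2} {i j : ℤ}
    (h : ∀ t : ℤ, 0 ≤ t → t < windowLength n → bit p (i + t) = bit q (j + t)) :
    (3 : ℤ) ^ n ∣ i - j := by
  induction n generalizing p q i j with
  | zero => simp
  | succ n ih =>
    rw [windowLength] at h
    push_cast at h
    have key : ∀ (p q : ℕ → ZMod 2) (i j : ℤ),
        (∀ t : ℤ, 0 ≤ t → t < 20 → bit p (i + t) = bit q (j + t)) →
        ∀ u, i = 3 * u + 1 → j % 3 = 1 := by
      rintro p q i j h u rfl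
      obtain ⟨t, ht0, ht, t', ht0', ht', hne⟩ := exists_bit_ne (fun n => p (n + 1)) u
      rw [← bit_three_mul_add_one, ← bit_three_mul_add_one,
        show 3 * (u + t) + 1 = 3 * u + 1 + 3 * t by ring,
        show 3 * (u + t') + 1 = 3 * u + 1 + 3 * t' by ring,
        h _ (by omega) (by omega), h _ (by omega) (by omega)] at hne
      obtain ⟨v, rfl⟩ | ⟨v, rfl⟩ | ⟨v, rfl⟩ := exists_eq_three_mul_add j
      · rw [← mul_add, ← mul_add, bit_three_mul, bit_three_mul] at hne
        exact (hne rfl).elim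
      · omega
      · rw [show 3 * v + 2 + 3 * t = 3 * (v + t) + 2 by ring,
          show 3 * v + 2 + 3 * t' = 3 * (v + t') + 2 by ring, bit_three_mul_add_two,
          bit_three_mul_add_two] at hne
        exact (hne rfl).elim
    obtain ⟨u, hu⟩ : ∃ u, i + (1 - i) % 3 = 3 * u + 1 := ⟨(i + (1 - i) % 3) / 3, by omega⟩
    have ht0 : 0 ≤ (1 - i) % 3 := by omega
    have ht3 : (1 - i) % 3 < 3 := by omega
    generalize (1 - i) % 3 = t₀ at hu ht0 ht3
    have hj : (j + t₀) % 3 = 1 := key p q _ _ (fun t h0 ht => by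
      rw [add_assoc, add_assoc]; exact h _ (by omega) (by omega)) u hu
    obtain ⟨v, hv⟩ : ∃ v, j + t₀ = 3 * v + 1 := ⟨(j + t₀) / 3, by omega⟩
    have huv := ih (p := fun n => p (n + 1)) (q := fun n => q (n + 1)) (i := u) (j := v)
      fun t h0 ht => by
        rw [← bit_three_mul_add_one, ← bit_three_mul_add_one,
          show 3 * (u + t) + 1 = i + (t₀ + 3 * t) by linarith,
          show 3 * (v + t) + 1 = j + (t₀ + 3 * t) by linarith]
        exact h _ (by omega) (by omega)
    rw [show i - j = 3 * (u - v) by linarith, pow_succ']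
    exact mul_dvd_mul_left _ huv

/-- If `p` and `q` agree below `n`, then every short window of the bit sequence of `p`, together
with the levels of its positions, occurs in the bit sequence of `q`. -/
theorem exists_bit_window_eq {p q : ℕ → ZMod 2} {n : ℕ} (hpq : ∀ k < n, p k = q k) {N : ℤ}
    (hN : 2 * N < 3 ^ n) (j : ℤ) : ∃ j' : ℤ, ∀ t : ℤ, |t| ≤ N →
      level (j' + t) = level (j + t) ∧ bit q (j' + t) = bit p (j + t) := by
  -- Since 2 * N < 3 ^ n, at most one position of the window has level at least n. If the parameters
  -- disagree there, a translation that swaps its digit and leaves the other positions unaffected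
  -- compensates.
  by_cases h : ∃ t₀ : ℤ, |t₀| ≤ N ∧ q (level (j + t₀)) ≠ p (level (j + t₀))
  · obtain ⟨t₀, ht₀, hne⟩ := h
    have hlev : n ≤ level (j + t₀) := by
      by_contra hlt
      exact hne (hpq _ (not_le.1 hlt)).symm
    have hq : q (level (j + t₀)) = p (level (j + t₀)) + 1 := by
      revert hne
      generalize p (level (j + t₀)) = a
      generalize q (level (j + t₀)) = b
      revert a b; decide
    obtain ⟨k, hk⟩ := exists_digit_swap (j + t₀)
    refine ⟨j + 3 ^ level (j + t₀) * k, fun t ht => ?_⟩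
    by_cases hlt : level (j + t) < n
    · have := level_digit_add_of_level_lt (hlt.trans_le hlev) k
      rw [add_right_comm, bit, bit, this.1, this.2, hpq _ hlt]
      exact ⟨rfl, rfl⟩
    · have hd := pow_dvd_sub_of_le_level (not_lt.1 hlt) hlev
      have : t = t₀ := by
        rw [show j + t - (j + t₀) = t - t₀ by ring] at hd
        have := Int.eq_zero_of_abs_lt_dvd hd (by
          have := abs_sub t t₀
          omega)
        omega
      subst this
      rw [add_right_comm, bit, bit, hk.1, hk.2, hq]
      refine ⟨rfl, ?_⟩
      generalize p (level (j + t)) = a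
      generalize digit (j + t) = b
      revert a b; decide
  · push Not at h
    exact ⟨j, fun t ht => ⟨rfl, by rw [bit, bit, h t ht]⟩⟩

/-! ### The rows -/

/-- An enumeration of all words in three letters. -/
def rowWord (n : ℕ) : List (Fin 3) := (Encodable.decode n).getD []

theorem exists_rowWord_eq (l : List (Fin 3)) : ∃ n, rowWord n = l :=
  ⟨Encodable.encode l, by rw [rowWord, Encodable.encodek, Option.getD_some]⟩

/-- The periodic repetition of the word `rowWord n` followed by a blank. -/
def row (n : ℕ) (i : ℤ) : Option (Fin 3) :=
  (rowWord n)[(i % ((rowWord n).length + 1)).toNat]?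

theorem row_eq_of_dvd {n : ℕ} {i j : ℤ} (h : ((rowWord n).length + 1 : ℤ) ∣ i - j) :
    row n i = row n j := by
  rw [row, row, Int.emod_eq_emod_iff_emod_sub_eq_zero.2 (Int.emod_eq_zero_of_dvd h)]

theorem row_eq_none_iff {n : ℕ} {i : ℤ} :
    row n i = none ↔ ((rowWord n).length + 1 : ℤ) ∣ i + 1 := by
  rw [row, List.getElem?_eq_none_iff]
  generalize (rowWord n).length = m
  have h₀ := Int.emod_nonneg i (by omega : (m + 1 : ℤ) ≠ 0)
  have h₁ := Int.emod_lt_of_pos i (by omega : (0 : ℤ) < m + 1)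
  have h₂ := Int.emod_add_mul_ediv i (m + 1)
  constructor
  · intro h
    exact ⟨i / (m + 1) + 1, by rw [mul_add, mul_one]; omega⟩
  · rintro ⟨k, hk⟩
    by_contra hlt
    have h₃ : (m + 1 : ℤ) ∣ i % (m + 1) + 1 := ⟨k - i / (m + 1), by rw [mul_sub]; omega⟩
    have := Int.le_of_dvd (by omega) h₃
    omega

theorem row_natCast {n m : ℕ} (h : m < (rowWord n).length + 1) : row n m = (rowWord n)[m]? := by
  rw [row, Int.emod_eq_of_lt (by omega) (by omega), Int.toNat_natCast]

/-! ### The configurations -/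

/-- An encoding of pairs of an edge label and a bit by symbols. -/
noncomputable def symbol : Option (Fin 3) × ZMod 2 ↪ Fin 36 :=
  -- There are 4 · 2 = 8 pairs, so 36 symbols are more than enough.
  (Function.Embedding.nonempty_of_card_le (by decide)).some

/-- The edge label that is encoded by a symbol. -/
noncomputable def edgeLabel (a : Fin 36) : Option (Fin 3) := (Function.invFun symbol a).1

/-- The bit that is encoded by a symbol. -/
noncomputable def symbolBit (a : Fin 36) : ZMod 2 := (Function.invFun symbol a).2

/-- The configuration that has in row `j` the repetition of the word with number `level j`, and the
bits given by `p`. -/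
noncomputable def config (p : ℕ → ZMod 2) (q : ℤ × ℤ) : Fin 36 :=
  symbol (row (level q.2) q.1, bit p q.2)

theorem edgeLabel_symbol (c : Option (Fin 3) × ZMod 2) : edgeLabel (symbol c) = c.1 := by
  rw [edgeLabel, Function.leftInverse_invFun symbol.injective]

theorem symbolBit_symbol (c : Option (Fin 3) × ZMod 2) : symbolBit (symbol c) = c.2 := by
  rw [symbolBit, Function.leftInverse_invFun symbol.injective]

theorem edgeLabel_config (p : ℕ → ZMod 2) (q : ℤ × ℤ) :
    edgeLabel (config p q) = row (level q.2) q.1 := edgeLabel_symbol _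

theorem symbolBit_config (p : ℕ → ZMod 2) (q : ℤ × ℤ) :
    symbolBit (config p q) = bit p q.2 := symbolBit_symbol _

/-- Around a position of level n the symbol repeats horizontally with the length of `rowWord n` plus
one, and vertically with 3 ^ (n + 1). -/
theorem isToeplitzFunction_config (p : ℕ → ZMod 2) : IsToeplitzFunction (config p) := by
  let _ := profiniteTopology (ℤ × ℤ)
  refine continuous_def.2 fun U _ => isOpen_iff_forall_mem_open.2 fun q hq => ?_
  let H : AddSubgroup (ℤ × ℤ) :=
    (AddSubgroup.zmultiples ((rowWord (level q.2)).length + 1 : ℤ)).prod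
      (AddSubgroup.zmultiples ((3 : ℤ) ^ (level q.2 + 1)))
  have hH : H.FiniteIndex := by
    constructor
    rw [AddSubgroup.index_prod, Int.index_zmultiples, Int.index_zmultiples]
    refine mul_ne_zero (Int.natAbs_ne_zero.2 (by omega)) (Int.natAbs_ne_zero.2 (by positivity))
  refine ⟨(q + ·) '' (H : Set (ℤ × ℤ)), ?_, .basic _ ⟨H, q, hH, rfl⟩, 0, H.zero_mem, add_zero q⟩
  rintro _ ⟨h, hh, rfl⟩
  obtain ⟨h₁, h₂⟩ := AddSubgroup.mem_prod.1 hh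
  rw [Int.mem_zmultiples_iff] at h₁ h₂
  have hl := level_digit_congr (i := q.2) (j := (q + h).2) (Nat.lt_succ_self _)
    (by rw [Prod.snd_add, sub_add_cancel_left]; exact (dvd_neg.2 h₂))
  have : config p (q + h) = config p q := by
    rw [config, config, bit, bit, hl.1, hl.2, row_eq_of_dvd (j := q.1)]
    rwa [Prod.fst_add, add_sub_cancel_left]
  rwa [mem_preimage, this]

/-! ### Orbit closures -/

section OrbitClosure

variable {A G : Type*} [TopologicalSpace A] [AddGroup G]

/-- The orbit closure of a configuration. -/
def orbitClosure (x : G → A) : Subshift A G where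
  carrier := closure (range fun s : G => shift (-s) x)
  isClosed := isClosed_closure
  mapsTo g := by
    refine MapsTo.closure ?_ (continuous_shift g)
    rintro _ ⟨s, rfl⟩
    refine ⟨-g + s, ?_⟩
    funext t
    simp [add_assoc]

theorem mem_orbitClosure_iff [DiscreteTopology A] {x z : G → A} :
    z ∈ (orbitClosure x).carrier ↔ ∀ F : Finset G, ∃ q, ∀ t ∈ F, z t = x (q + t) := by
  refine mem_closure_iff.trans ⟨fun h F => ?_, fun h o ho hz => ?_⟩
  · obtain ⟨_, hy, s, rfl⟩ := h _ (isOpen_cylinder F z) fun _ _ => rfl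
    exact ⟨-s, fun t ht => (hy t ht).symm⟩
  · obtain ⟨I, u, hu, hI⟩ := isOpen_pi_iff.1 ho z hz
    obtain ⟨q, hq⟩ := h I
    refine ⟨shift (-(-q)) x, hI fun t ht => ?_, -q, rfl⟩
    rw [neg_neg, shift_apply, ← hq t ht]
    exact (hu t ht).2

theorem shift_mem_orbitClosure (x : G → A) (q : G) : shift q x ∈ (orbitClosure x).carrier :=
  subset_closure ⟨-q, by simp⟩

theorem mem_orbitClosure (x : G → A) : x ∈ (orbitClosure x).carrier := by
  simpa using shift_mem_orbitClosure x 0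

end OrbitClosure

theorem isToeplitzSubshift_orbitClosure_config (p : ℕ → ZMod 2) :
    IsToeplitzSubshift (orbitClosure (config p)) :=
  ⟨config p, isToeplitzFunction_config p, rfl⟩

/-! ### Freeness -/

/-- By recognizability the vertical part of a period is divisible by every power of 3, hence zero.
The horizontal part is then a period of rows of every level, and the spacing of blanks in these is
unbounded. -/
theorem isFreeSubshift_orbitClosure_config (p : ℕ → ZMod 2) :
    IsFreeSubshift (orbitClosure (config p)) := by
  classical
  rintro s ⟨y, hy⟩ hs
  have hper : ∀ t, y (-s + t) = y t := fun t => congrFun (congrArg Subtype.val hs) t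
  have hwin : ∀ F : Finset (ℤ × ℤ), ∃ q, ∀ t ∈ F, y t = config p (q + t) ∧
      config p (q + (-s + t)) = config p (q + t) := fun F => by
    obtain ⟨q, hq⟩ := mem_orbitClosure_iff.1 hy (F ∪ F.image (-s + ·))
    refine ⟨q, fun t ht => ?_⟩
    have h₁ := hq t (Finset.mem_union_left _ ht)
    have h₂ := hq (-s + t) (Finset.mem_union_right _ (Finset.mem_image_of_mem _ ht))
    exact ⟨h₁, by rw [← h₁, ← h₂, hper]⟩
  have h2 : ∀ n : ℕ, (3 : ℤ) ^ n ∣ s.2 := fun n => by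
    obtain ⟨q, hq⟩ := hwin ({0} ×ˢ Finset.Ico 0 (windowLength n : ℤ))
    have := pow_dvd_sub_of_bit_eq n (p := p) (q := p) (i := q.2) (j := q.2 - s.2) fun t h0 ht => by
      have := congrArg symbolBit (hq (0, t) (by simp [h0, ht])).2
      rw [symbolBit_config, symbolBit_config] at this
      rw [show q.2 - s.2 + t = q.2 + (-s.2 + t) by ring]
      exact this.symm
    simpa using this
  have hs2 : s.2 = 0 := by
    refine Int.eq_zero_of_abs_lt_dvd (h2 s.2.natAbs) ?_
    rw [Int.abs_eq_natAbs]
    exact_mod_cast Nat.lt_pow_self (by norm_num)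
  -- In rows with a word of length |s.1| the blanks lie |s.1| + 1 apart, which forces |s.1| + 1 to
  -- divide s.1.
  obtain ⟨n, hn⟩ := exists_rowWord_eq (List.replicate s.1.natAbs 0)
  have hlen : (rowWord n).length = s.1.natAbs := by rw [hn, List.length_replicate]
  obtain ⟨q, hq⟩ := hwin (Finset.Icc 0 (s.1.natAbs : ℤ) ×ˢ Finset.Ico 0 ((3 : ℤ) ^ (n + 1)))
  obtain ⟨t, ht0, ht, hlev⟩ := exists_level_add_eq n q.2
  have hs1 : ((rowWord n).length + 1 : ℤ) ∣ s.1 := by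
    obtain ⟨u, hu0, hu, hdvd⟩ : ∃ u : ℤ, 0 ≤ u ∧ u ≤ s.1.natAbs ∧
        ((rowWord n).length + 1 : ℤ) ∣ q.1 + u + 1 := by
      rw [hlen]
      refine ⟨(-q.1 - 1) % (s.1.natAbs + 1), Int.emod_nonneg _ (by omega), ?_, ?_⟩
      · have := Int.emod_lt_of_pos (-q.1 - 1) (by omega : (0 : ℤ) < s.1.natAbs + 1)
        omega
      · have := Int.emod_add_mul_ediv (-q.1 - 1) (s.1.natAbs + 1)
        exact ⟨-((-q.1 - 1) / (s.1.natAbs + 1)), by linarith⟩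
    have := congrArg edgeLabel (hq (u, t) (by
      rw [Finset.mem_product, Finset.mem_Icc, Finset.mem_Ico]; exact ⟨⟨hu0, hu⟩, ht0, ht⟩)).2
    rw [edgeLabel_config, edgeLabel_config] at this
    simp only [Prod.snd_add, Prod.fst_add, Prod.snd_neg, Prod.fst_neg, hs2, neg_zero, zero_add,
      hlev] at this
    rw [row_eq_none_iff.2 hdvd, row_eq_none_iff] at this
    have := dvd_sub hdvd this
    rwa [show q.1 + u + 1 - (q.1 + (-s.1 + u) + 1) = s.1 by ring] at this
  refine Prod.ext (Int.eq_zero_of_abs_lt_dvd hs1 ?_) hs2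
  rw [hlen, Int.abs_eq_natAbs]
  omega

/-! ### Involutions in the topological full group -/

theorem continuous_subshift_vadd {A G : Type*} [TopologicalSpace A] [AddGroup G]
    (X : Subshift A G) (s : G) : Continuous fun y : X.carrier => s +ᵥ y :=
  ((continuous_shift (-s)).comp continuous_subtype_val).subtype_mk _

theorem isClopen_preimage_apply {A G : Type*} [TopologicalSpace A] [DiscreteTopology A] [AddGroup G]
    (X : Subshift A G) (g : G) (S : Set A) : IsClopen {y : X.carrier | y.1 g ∈ S} :=
  (isClopen_discrete S).preimage ((continuous_apply g).comp continuous_subtype_val)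

/-- The horizontal edge from `q` to `q + (1, 0)` is labelled `k`, and its two neighbours are
not. -/
def IsActiveEdge (k : Fin 3) (y : ℤ × ℤ → Fin 36) (q : ℤ × ℤ) : Prop :=
  edgeLabel (y q) = some k ∧ edgeLabel (y ((-1, 0) + q)) ≠ some k ∧
    edgeLabel (y ((1, 0) + q)) ≠ some k

section EdgeSwap

variable {X : Subshift (Fin 36) (ℤ × ℤ)}

theorem isActiveEdge_vadd {k : Fin 3} {y : X.carrier} {s q : ℤ × ℤ} :
    IsActiveEdge k (s +ᵥ y).1 q ↔ IsActiveEdge k y.1 (-s + q) := by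
  simp only [IsActiveEdge, subshift_vadd_apply, add_left_comm]

theorem isClopen_isActiveEdge (X : Subshift (Fin 36) (ℤ × ℤ)) (k : Fin 3) (q : ℤ × ℤ) :
    IsClopen {y : X.carrier | IsActiveEdge k y.1 q} :=
  (isClopen_preimage_apply X q {a | edgeLabel a = some k}).inter
    ((isClopen_preimage_apply X _ {a | edgeLabel a ≠ some k}).inter
      (isClopen_preimage_apply X _ {a | edgeLabel a ≠ some k}))

open Classical in
/-- Move along the active edge labelled `k` at the origin, if there is one. -/
noncomputable def edgeSwap (k : Fin 3) (y : X.carrier) : X.carrier :=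
  if IsActiveEdge k y.1 0 then ((-1, 0) : ℤ × ℤ) +ᵥ y
  else if IsActiveEdge k y.1 (-1, 0) then ((1, 0) : ℤ × ℤ) +ᵥ y else y

theorem edgeSwap_of_isActiveEdge_zero {k : Fin 3} {y : X.carrier} (h : IsActiveEdge k y.1 0) :
    edgeSwap k y = ((-1, 0) : ℤ × ℤ) +ᵥ y := if_pos h

/-- Two edges with a common vertex are never both active for the same label, so the first case of
`edgeSwap` does not interfere. -/
theorem edgeSwap_of_isActiveEdge_neg {k : Fin 3} {y : X.carrier} (h : IsActiveEdge k y.1 (-1, 0)) :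
    edgeSwap k y = ((1, 0) : ℤ × ℤ) +ᵥ y :=
  (if_neg fun h' => h.2.2 h'.1).trans (if_pos h)

theorem edgeSwap_edgeSwap (k : Fin 3) (y : X.carrier) : edgeSwap k (edgeSwap k y) = y := by
  by_cases h₀ : IsActiveEdge k y.1 0
  · rw [edgeSwap_of_isActiveEdge_zero h₀, edgeSwap_of_isActiveEdge_neg, vadd_vadd]
    · exact zero_vadd _ y
    · exact isActiveEdge_vadd.2 h₀
  · by_cases h₁ : IsActiveEdge k y.1 (-1, 0)
    · rw [edgeSwap_of_isActiveEdge_neg h₁, edgeSwap_of_isActiveEdge_zero, vadd_vadd]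
      · exact zero_vadd _ y
      · exact isActiveEdge_vadd.2 h₁
    · have : edgeSwap k y = y := (if_neg h₀).trans (if_neg h₁)
      rw [this, this]

theorem continuous_edgeSwap (k : Fin 3) : Continuous (edgeSwap k : X.carrier → X.carrier) := by
  classical
  refine continuous_if (fun a ha => ?_) (continuous_subshift_vadd X _).continuousOn
    (continuous_if (fun a ha => ?_) (continuous_subshift_vadd X _).continuousOn
      continuousOn_id).continuousOn
  · rw [(isClopen_isActiveEdge X k _).frontier_eq] at ha
    exact ha.elim
  · rw [(isClopen_isActiveEdge X k _).frontier_eq] at ha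
    exact ha.elim

/-- `edgeSwap` as an element of the topological full group. -/
noncomputable def edgeSwapFull (X : Subshift (Fin 36) (ℤ × ℤ)) (k : Fin 3) :
    topologicalFullGroup (ℤ × ℤ) X.carrier where
  val :=
    { toFun := edgeSwap k
      invFun := edgeSwap k
      left_inv := edgeSwap_edgeSwap k
      right_inv := edgeSwap_edgeSwap k
      continuous_toFun := continuous_edgeSwap k
      continuous_invFun := continuous_edgeSwap k }
  property := by
    classical
    let P : X.carrier → Fin 3 := fun y => if IsActiveEdge k y.1 0 then 0 else
      if IsActiveEdge k y.1 (-1, 0) then 1 else 2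
    have hP : Continuous P := by
      refine continuous_if (fun a ha => ?_) continuousOn_const
        (continuous_if (fun a ha => ?_) continuousOn_const continuousOn_const).continuousOn
      · rw [(isClopen_isActiveEdge X k _).frontier_eq] at ha
        exact ha.elim
      · rw [(isClopen_isActiveEdge X k _).frontier_eq] at ha
        exact ha.elim
    refine ⟨3, fun i => P ⁻¹' {i}, ![(-1, 0), (1, 0), 0], fun i => (isClopen_discrete _).preimage hP,
      fun i j hij => (disjoint_singleton.2 hij).preimage P, ?_, ?_⟩
    · rw [← preimage_iUnion, iUnion_of_singleton, preimage_univ]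
    · rintro _ y rfl
      change edgeSwap k y = _
      simp only [P, edgeSwap]
      split_ifs
      · rfl
      · rfl
      · exact (zero_vadd _ y).symm

theorem edgeSwapFull_apply (k : Fin 3) (y : X.carrier) :
    (edgeSwapFull X k : X.carrier ≃ₜ X.carrier) y = edgeSwap k y := rfl

theorem edgeSwapFull_mul_self (k : Fin 3) : edgeSwapFull X k * edgeSwapFull X k = 1 :=
  Subtype.ext (Homeomorph.ext (edgeSwap_edgeSwap k))

end EdgeSwap

/-- The base point of the orbit closure. -/
def basePoint {A G : Type*} [TopologicalSpace A] [AddGroup G] (x : G → A) :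
    (orbitClosure x).carrier := ⟨x, mem_orbitClosure x⟩

/-- Neighbouring letters of a reduced word differ, and the periodic repetition puts a blank before
its first letter and after its last. -/
theorem isActiveEdge_config {p : ℕ → ZMod 2} {l : List (Fin 3)} (hl : l.IsChain (· ≠ ·)) {j : ℤ}
    (hj : rowWord (level j) = l) {m : ℕ} (hm : m < l.length) :
    IsActiveEdge l[m] (config p) (m, j) := by
  subst hj
  simp only [IsActiveEdge, edgeLabel_config, Prod.mk_add_mk, zero_add]
  refine ⟨?_, ?_, ?_⟩
  · rw [row_natCast (by omega), List.getElem?_eq_getElem hm]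
  · rcases m with _ | m
    · rw [row_eq_none_iff.2 (by simp)]
      simp
    · rw [show (-1 + (m + 1 : ℕ) : ℤ) = m by push_cast; ring, row_natCast (by omega),
        List.getElem?_eq_getElem (by omega)]
      simpa using List.isChain_iff_getElem.1 hl m hm
  · rw [show (1 + (m : ℕ) : ℤ) = (m + 1 : ℕ) by push_cast; ring, row_natCast (by omega)]
    by_cases h : m + 1 < (rowWord (level j)).length
    · rw [List.getElem?_eq_getElem h]
      simpa using (List.isChain_iff_getElem.1 hl m h).symm
    · rw [List.getElem?_eq_none (by omega)]
      simp

/-- The rightmost factor acts first, so the point walks along the row from vertex m back to vertex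
0, each factor crossing the edge with its own letter. -/
theorem prod_edgeSwapFull_apply {p : ℕ → ZMod 2} {l : List (Fin 3)} (hl : l.IsChain (· ≠ ·)) {j : ℤ}
    (hj : rowWord (level j) = l) (m : ℕ) (hm : m ≤ l.length) :
    (((l.take m).map (edgeSwapFull (orbitClosure (config p)))).prod : _ ≃ₜ _)
      (((-m, -j) : ℤ × ℤ) +ᵥ basePoint (config p)) = ((0, -j) : ℤ × ℤ) +ᵥ basePoint (config p) := by
  induction m with
  | zero => rfl
  | succ m ih =>
    rw [List.take_add_one, List.getElem?_eq_getElem (by omega), List.map_append, List.prod_append]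
    simp only [Option.toList_some, List.map_cons, List.map_nil, List.prod_singleton,
      Subgroup.coe_mul, Homeomorph.mul_apply, edgeSwapFull_apply]
    rw [edgeSwap_of_isActiveEdge_neg, vadd_vadd, ← ih (by omega)]
    · congr 2
      ext <;> simp
    · rw [isActiveEdge_vadd]
      have he : -(-((m + 1 : ℕ) : ℤ), -j) + (-1, 0) = ((m : ℤ), j) := by ext <;> simp
      rw [he]
      exact isActiveEdge_config hl hj (by omega)

/-- A reduced word, applied in a row that contains it, moves a point by its length; by freeness this
is a different point. -/
theorem not_isAmenableGroup_topologicalFullGroup_config (p : ℕ → ZMod 2) :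
    ¬ IsAmenableGroup (topologicalFullGroup (ℤ × ℤ) (orbitClosure (config p)).carrier) := by
  refine not_isAmenableGroup_of_involutions (edgeSwapFull _) edgeSwapFull_mul_self
    fun l hne hl h => ?_
  obtain ⟨n, hn⟩ := exists_rowWord_eq l
  obtain ⟨j, rfl⟩ := exists_level_eq n
  have h₁ := prod_edgeSwapFull_apply (p := p) hl hn l.length le_rfl
  rw [List.take_length, h, Subgroup.coe_one, Homeomorph.one_apply] at h₁
  have h₂ := isFreeSubshift_orbitClosure_config p (-(0, -j) + (-(l.length : ℤ), -j)) (basePoint _)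
    (by rw [add_vadd, h₁, neg_vadd_vadd])
  have := congrArg Prod.fst h₂
  simp at this
  exact hne this

/-! ### Changing the parameter on one level -/

/-- Near `q`, the bits of `y` look like those near an integer of level `n`. -/
def LooksLikeLevel (n : ℕ) (y : ℤ × ℤ → Fin 36) (q : ℤ × ℤ) : Prop :=
  ∃ (p : ℕ → ZMod 2) (j : ℤ), level j = n ∧ ∀ t : ℤ, 0 ≤ t → t < windowLength (n + 1) →
    symbolBit (y (q + (0, t))) = bit p (j + t)

theorem looksLikeLevel_shift {n : ℕ} {y : ℤ × ℤ → Fin 36} {s q : ℤ × ℤ} :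
    LooksLikeLevel n (shift s y) q ↔ LooksLikeLevel n y (s + q) := by
  simp only [LooksLikeLevel, shift_apply, add_assoc]

theorem looksLikeLevel_congr {n : ℕ} {y z : ℤ × ℤ → Fin 36} {q : ℤ × ℤ}
    (h : ∀ t : ℤ, 0 ≤ t → t < windowLength (n + 1) → z (q + (0, t)) = y (q + (0, t))) :
    LooksLikeLevel n z q ↔ LooksLikeLevel n y q :=
  exists₂_congr fun _ _ => and_congr_right fun _ =>
    forall₃_congr fun t h0 ht => by rw [h t h0 ht]

/-- The window determines the position modulo 3 ^ (n + 1), and hence whether its level is n. As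
`LooksLikeLevel` quantifies over the parameter, the same rule works before and after a flip. -/
theorem looksLikeLevel_config {n : ℕ} {p : ℕ → ZMod 2} {q : ℤ × ℤ} :
    LooksLikeLevel n (config p) q ↔ level q.2 = n := by
  simp only [LooksLikeLevel, symbolBit_config, Prod.snd_add]
  refine ⟨?_, fun h => ⟨p, q.2, h, fun t _ _ => rfl⟩⟩
  rintro ⟨p', j, hj, h⟩
  exact (level_eq_iff_of_dvd (pow_dvd_sub_of_bit_eq (n + 1) h)).2 hj

open Classical in
/-- In the rows that look like rows of level `n`, change the bits. -/
noncomputable def flipLevel (n : ℕ) (y : ℤ × ℤ → Fin 36) (q : ℤ × ℤ) : Fin 36 :=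
  if LooksLikeLevel n y q then symbol (edgeLabel (y q), symbolBit (y q) + 1) else y q

theorem flipLevel_shift (n : ℕ) (y : ℤ × ℤ → Fin 36) (s : ℤ × ℤ) :
    flipLevel n (shift s y) = shift s (flipLevel n y) := by
  classical
  funext q
  exact if_congr looksLikeLevel_shift rfl rfl

theorem continuous_flipLevel (n : ℕ) : Continuous (flipLevel n) := by
  classical
  refine continuous_pi fun q => ?_
  let F : Finset (ℤ × ℤ) := (Finset.Ico 0 (windowLength (n + 1) : ℤ)).image fun t => q + (0, t)
  refine ((IsLocallyConstant.iff_exists_open _).2 fun y => ?_).continuous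
  refine ⟨cylinder (insert q F) y, isOpen_cylinder _ _, fun _ _ => rfl, fun z hz => ?_⟩
  have hq : z q = y q := hz q (Finset.mem_insert_self _ _)
  rw [flipLevel, flipLevel, hq]
  refine if_congr (looksLikeLevel_congr fun t h0 ht => hz _ ?_) rfl rfl
  exact Finset.mem_insert_of_mem (Finset.mem_image_of_mem _ (Finset.mem_Ico.2 ⟨h0, ht⟩))

theorem flipLevel_config (n : ℕ) (p : ℕ → ZMod 2) :
    flipLevel n (config p) = config (p + Pi.single n 1) := by
  classical
  funext q
  rw [flipLevel, if_congr looksLikeLevel_config rfl rfl, edgeLabel_config, symbolBit_config]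
  split_ifs with h
  · subst h
    rw [config, bit, bit, Pi.add_apply, Pi.single_eq_same, add_assoc]
  · rw [config, config, bit, bit, Pi.add_apply, Pi.single_eq_of_ne h, add_zero]

/-- A continuous shift-equivariant map maps orbit closures to orbit closures. -/
theorem mapsTo_orbitClosure {A G : Type*} [TopologicalSpace A] [AddGroup G]
    {F : (G → A) → G → A} (hF : Continuous F) (hs : ∀ s y, F (shift s y) = shift s (F y))
    (x : G → A) : MapsTo F (orbitClosure x).carrier (orbitClosure (F x)).carrier := by
  refine MapsTo.closure ?_ hF
  rintro _ ⟨s, rfl⟩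
  exact ⟨s, (hs _ _).symm⟩

theorem eqOn_orbitClosure {A G : Type*} [TopologicalSpace A] [T2Space A] [AddGroup G]
    {F : (G → A) → G → A} (hF : Continuous F) (hs : ∀ s y, F (shift s y) = shift s (F y))
    {x : G → A} (hx : F x = x) : EqOn F id (orbitClosure x).carrier := by
  refine EqOn.closure ?_ hF continuous_id
  rintro _ ⟨s, rfl⟩
  exact (hs _ _).trans (by rw [hx]; rfl)

/-- `flipLevel n` is a sliding block code that exchanges the two subshifts and is its own inverse
there. Being a conjugacy, it has the trivial cocycles. -/
theorem contOrbitEquiv_config_add_single (p : ℕ → ZMod 2) (n : ℕ) :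
    ContOrbitEquiv (ℤ × ℤ) (orbitClosure (config p)).carrier (ℤ × ℤ)
      (orbitClosure (config (p + Pi.single n 1))).carrier := by
  have hc := continuous_flipLevel n
  have hs := fun s y => flipLevel_shift n y s
  have h₁ := flipLevel_config n p
  have h₂ : flipLevel n (config (p + Pi.single n 1)) = config p := by
    rw [flipLevel_config, add_assoc, ← Pi.single_add, show (1 + 1 : ZMod 2) = 0 from rfl,
      Pi.single_zero, add_zero]
  have hm₁ : MapsTo (flipLevel n) (orbitClosure (config p)).carrier
      (orbitClosure (config (p + Pi.single n 1))).carrier := h₁ ▸ mapsTo_orbitClosure hc hs _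
  have hm₂ : MapsTo (flipLevel n) (orbitClosure (config (p + Pi.single n 1))).carrier
      (orbitClosure (config p)).carrier := by
    have := mapsTo_orbitClosure hc hs (config (p + Pi.single n 1))
    rwa [h₂] at this
  have hi : ∀ q, flipLevel n (flipLevel n (config q)) = config q →
      ∀ y ∈ (orbitClosure (config q)).carrier, flipLevel n (flipLevel n y) = y := fun q hq =>
    eqOn_orbitClosure (F := flipLevel n ∘ flipLevel n) (hc.comp hc)
      (fun s y => by simp only [Function.comp_apply, hs]) hq
  let Φ : (orbitClosure (config p)).carrier ≃ₜ
      (orbitClosure (config (p + Pi.single n 1))).carrier :=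
    { toFun := hm₁.restrict
      invFun := hm₂.restrict
      left_inv := fun y => Subtype.ext (hi p (by rw [h₁, h₂]) y.1 y.2)
      right_inv := fun y => Subtype.ext (hi (p + Pi.single n 1) (by rw [h₂, h₁]) y.1 y.2)
      continuous_toFun := hc.restrict hm₁
      continuous_invFun := hc.restrict hm₂ }
  exact ⟨Φ, ⟨Prod.fst, continuous_fst⟩, ⟨Prod.fst, continuous_fst⟩,
    fun s y => Subtype.ext (hs _ _), fun s y => Subtype.ext (hs _ _)⟩

/-! ### Continuity in the parameter -/

theorem continuous_config : Continuous config :=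
  continuous_pi fun q => (continuous_of_discreteTopology
    (f := fun b : ZMod 2 => symbol (row (level q.2) q.1, digit q.2 + b))).comp
      (continuous_apply (level q.2))

theorem exists_config_window_eq {p p' : ℕ → ZMod 2} {n : ℕ} (hp : ∀ k < n, p k = p' k) {N : ℤ}
    (hN : 2 * N < 3 ^ n) (q : ℤ × ℤ) :
    ∃ q', ∀ t : ℤ × ℤ, |t.2| ≤ N → config p' (q' + t) = config p (q + t) := by
  obtain ⟨j, hj⟩ := exists_bit_window_eq hp hN q.2
  refine ⟨(q.1, j), fun t ht => ?_⟩
  rw [config, config, Prod.snd_add, Prod.snd_add, (hj _ ht).1, (hj _ ht).2]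
  rfl

/-- Which patterns of bounded height occur in `config p` depends only on finitely many coordinates
of p, so a pattern missing for p is missing for all nearby parameters. -/
theorem isClosed_graph_orbitClosure_config :
    IsClosed {z : (ℕ → ZMod 2) × (ℤ × ℤ → Fin 36) | z.2 ∈ (orbitClosure (config z.1)).carrier} := by
  refine isOpen_compl_iff.1 (isOpen_iff_forall_mem_open.2 fun ⟨p, z⟩ hz => ?_)
  simp only [mem_compl_iff, mem_ofPred_eq, mem_orbitClosure_iff, not_forall] at hz
  obtain ⟨F, hF⟩ := hz
  obtain ⟨N, hN⟩ : ∃ N : ℤ, ∀ t ∈ F, |t.2| ≤ N :=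
    ⟨∑ t ∈ F, |t.2|, fun t ht => Finset.single_le_sum (f := fun t : ℤ × ℤ => |t.2|)
      (fun _ _ => abs_nonneg _) ht⟩
  obtain ⟨n, hn⟩ : ∃ n : ℕ, 2 * N < 3 ^ n := pow_unbounded_of_one_lt _ (by norm_num)
  refine ⟨PiNat.cylinder p n ×ˢ cylinder F z, ?_,
    (PiNat.isOpen_cylinder _ p n).prod (isOpen_cylinder F z),
    PiNat.self_mem_cylinder p n, fun _ _ => rfl⟩
  rintro ⟨p', z'⟩ ⟨hp', hz'⟩ hmem
  obtain ⟨q, hq⟩ := mem_orbitClosure_iff.1 hmem F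
  obtain ⟨q', hq'⟩ := exists_config_window_eq (p := p') (p' := p) hp' hn q
  exact hF ⟨q', fun t ht => by rw [hq' t (hN t ht), ← hq t ht, hz' t ht]⟩

theorem continuous_orbitClosure_config :
    Continuous fun p : ℕ → ZMod 2 => orbitClosure (config p) := by
  refine continuous_induced_rng.2 (continuous_generateFrom_iff.2 ?_)
  rintro _ (⟨U, hU, rfl⟩ | ⟨U, hU, rfl⟩) <;> rw [mem_ofPred_eq] at hU
  -- Being contained in U is an open condition: the parameters violating it are the projection of a
  -- closed set along a compact factor.
  · have := isClosedMap_fst_of_compactSpace _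
      (isClosed_graph_orbitClosure_config.inter (hU.isClosed_compl.preimage continuous_snd))
    convert this.isOpen_compl using 1
    ext p
    simp only [mem_preimage, Function.comp_apply, mem_powerset_iff, mem_compl_iff, mem_image,
      not_exists, mem_inter_iff, Prod.forall, not_and, mem_ofPred_eq]
    refine ⟨fun h p' y hy hp => hy.2 (h (hp ▸ hy.1)), fun h y hy => ?_⟩
    by_contra hyU
    exact h p y ⟨hy, hyU⟩ rfl
  -- Meeting U is an open condition since it is already witnessed by a shift of `config p`.
  · have : IsOpen (⋃ s : ℤ × ℤ, (fun p => shift (-s) (config p)) ⁻¹' U) :=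
      isOpen_iUnion fun s => hU.preimage ((continuous_shift (-s)).comp continuous_config)
    convert this using 1
    ext p
    simp only [mem_preimage, Function.comp_apply, mem_ofPred_eq, orbitClosure, mem_iUnion]
    rw [closure_inter_open_nonempty_iff hU]
    constructor
    · rintro ⟨_, ⟨s, rfl⟩, h⟩
      exact ⟨s, h⟩
    · rintro ⟨s, h⟩
      exact ⟨_, ⟨s, rfl⟩, h⟩

/-- A matching window is aligned modulo 3 ^ (n + 1), so a position of level n is compared with one
of the same level and digit. Equality of the bits leaves p n = p' n. -/
theorem injective_orbitClosure_config :
    Function.Injective fun p : ℕ → ZMod 2 => orbitClosure (config p) := by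
  intro p p' h
  have hmem : config p ∈ (orbitClosure (config p')).carrier := by
    rw [← show orbitClosure (config p) = orbitClosure (config p') from h]
    exact mem_orbitClosure _
  funext n
  obtain ⟨c, hc⟩ := exists_level_eq n
  obtain ⟨q, hq⟩ := mem_orbitClosure_iff.1 hmem
    ({0} ×ˢ insert c (Finset.Ico 0 (windowLength (n + 1) : ℤ)))
  have hbit : ∀ t ∈ insert c (Finset.Ico 0 (windowLength (n + 1) : ℤ)),
      bit p t = bit p' (q.2 + t) := fun t ht => by
    have := congrArg symbolBit (hq (0, t) (by simpa using ht))
    rwa [symbolBit_config, symbolBit_config] at this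
  have hdvd : (3 : ℤ) ^ (n + 1) ∣ 0 - q.2 := pow_dvd_sub_of_bit_eq (n + 1) fun t h0 ht => by
    rw [zero_add]
    exact hbit t (Finset.mem_insert_of_mem (Finset.mem_Ico.2 ⟨h0, ht⟩))
  have hl := level_digit_congr (i := c) (j := q.2 + c) (n := n + 1) (by omega)
    (by rwa [show c - (q.2 + c) = 0 - q.2 by ring])
  have := hbit c (Finset.mem_insert_self _ _)
  rw [bit, bit, hl.1, hl.2, hc] at this
  exact add_left_cancel this

/-! ### Countability of continuous orbit equivalence classes -/

/-- A continuous map to a discrete space has finitely many fibres, all compact; its values on them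
are an open condition in the compact-open topology. -/
theorem discreteTopology_continuousMap (X D : Type*) [TopologicalSpace X] [CompactSpace X]
    [TopologicalSpace D] [DiscreteTopology D] : DiscreteTopology C(X, D) := by
  refine discreteTopology_iff_isOpen_singleton.2 fun f => ?_
  have hfin : (range f).Finite := (isCompact_range f.continuous).finite_of_discrete
  have hopen : IsOpen (⋂ d ∈ range f, {g : C(X, D) | MapsTo g (f ⁻¹' {d}) {d}}) :=
    hfin.isOpen_biInter fun d _ => ContinuousMap.isOpen_setOfPred_mapsTo
      ((isClosed_discrete _).preimage f.continuous).isCompact (isOpen_discrete _)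
  convert hopen using 1
  ext g
  simp only [mem_singleton_iff, mem_iInter, mem_ofPred_eq]
  refine ⟨?_, fun h => ContinuousMap.ext fun x => h (f x) ⟨x, rfl⟩ rfl⟩
  rintro rfl d _ x hx
  exact hx

theorem countable_continuousMap (X D : Type*) [TopologicalSpace X] [CompactSpace X] [T2Space X]
    [SecondCountableTopology X] [TopologicalSpace D] [DiscreteTopology D] [Countable D] :
    Countable C(X, D) :=
  have := discreteTopology_continuousMap X D
  countable_of_Lindelof_of_discrete

theorem Subshift.eq_of_equivariant_of_apply_zero {A : Type*} [TopologicalSpace A]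
    {Y Z : Subshift A (ℤ × ℤ)} (Ψ : Y.carrier ≃ Z.carrier)
    (h₁ : ∀ y, Ψ (((1, 0) : ℤ × ℤ) +ᵥ y) = ((1, 0) : ℤ × ℤ) +ᵥ Ψ y)
    (h₂ : ∀ y, Ψ (((0, 1) : ℤ × ℤ) +ᵥ y) = ((0, 1) : ℤ × ℤ) +ᵥ Ψ y)
    (h₀ : ∀ y, (Ψ y).1 0 = y.1 0) : Y = Z := by
  let S : AddSubgroup (ℤ × ℤ) :=
    { carrier := {g | ∀ y, Ψ (g +ᵥ y) = g +ᵥ Ψ y}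
      zero_mem' := fun y => by rw [zero_vadd, zero_vadd]
      add_mem' := fun {g h} hg hh y => by rw [add_vadd, hg, hh, add_vadd]
      neg_mem' := fun {g} hg y => by rw [eq_neg_vadd_iff, ← hg, vadd_neg_vadd] }
  have hS : ∀ g : ℤ × ℤ, g ∈ S := fun g => by
    have := S.add_mem (S.zsmul_mem (show ((1, 0) : ℤ × ℤ) ∈ S from h₁) g.1)
      (S.zsmul_mem (show ((0, 1) : ℤ × ℤ) ∈ S from h₂) g.2)
    simpa using this
  have hΨ : ∀ y, (Ψ y).1 = y.1 := fun y => funext fun t => by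
    have := h₀ (-t +ᵥ y)
    rw [hS (-t) y, subshift_vadd_apply, subshift_vadd_apply] at this
    simpa using this
  have hc : Y.carrier = Z.carrier := by
    ext z
    refine ⟨fun hz => ?_, fun hz => ?_⟩
    · have := hΨ ⟨z, hz⟩
      change _ = z at this
      rw [← this]
      exact (Ψ _).2
    · have := hΨ (Ψ.symm ⟨z, hz⟩)
      rw [Ψ.apply_symm_apply] at this
      change z = _ at this
      rw [this]
      exact (Ψ.symm _).2
  cases Y
  cases Z
  cases hc
  rfl

/-- Y is recovered from three continuous functions on X: the cocycle of the inverse homeomorphism at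
the two generators of ℤ², and the symbol of Φ x at the origin. There are countably many such
triples. -/
theorem countable_contOrbitEquiv {A : Type*} [Finite A] [TopologicalSpace A] [DiscreteTopology A]
    (X : Subshift A (ℤ × ℤ)) :
    {Y : Subshift A (ℤ × ℤ) | ContOrbitEquiv (ℤ × ℤ) X.carrier (ℤ × ℤ) Y.carrier}.Countable := by
  have : CompactSpace X.carrier := isCompact_iff_compactSpace.1 X.isClosed.isCompact
  have := countable_continuousMap X.carrier (ℤ × ℤ)
  have := countable_continuousMap X.carrier A
  have hdata : ∀ Y : {Y : Subshift A (ℤ × ℤ) |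
      ContOrbitEquiv (ℤ × ℤ) X.carrier (ℤ × ℤ) Y.carrier},
      ∃ d : C(X.carrier, ℤ × ℤ) × C(X.carrier, ℤ × ℤ) × C(X.carrier, A),
        ∃ Φ : X.carrier ≃ Y.1.carrier, (∀ x, Φ (d.1 x +ᵥ x) = ((1, 0) : ℤ × ℤ) +ᵥ Φ x) ∧
          (∀ x, Φ (d.2.1 x +ᵥ x) = ((0, 1) : ℤ × ℤ) +ᵥ Φ x) ∧ ∀ x, d.2.2 x = (Φ x).1 0 := by
    rintro ⟨Y, Φ, κ, l, -, hl⟩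
    have key : ∀ (s : ℤ × ℤ) (x : X.carrier), Φ (l (s, Φ x) +ᵥ x) = s +ᵥ Φ x := fun s x => by
      have := hl s (Φ x)
      rw [Φ.symm_apply_apply] at this
      rw [← this, Φ.apply_symm_apply]
    exact ⟨⟨⟨fun x => l ((1, 0), Φ x), by fun_prop⟩, ⟨fun x => l ((0, 1), Φ x), by fun_prop⟩,
      ⟨fun x => (Φ x).1 0,
        (continuous_apply 0).comp (continuous_subtype_val.comp Φ.continuous)⟩⟩, Φ.toEquiv, key _, key _, fun _ => rfl⟩
  choose d hd using hdata
  refine Set.countable_coe_iff.1 (Function.Injective.countable (f := d) fun Y Z hYZ => ?_)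
  obtain ⟨Φ, h₁, h₂, h₀⟩ := hd Y
  obtain ⟨Φ', h₁', h₂', h₀'⟩ := hd Z
  rw [← hYZ] at h₁' h₂' h₀'
  refine Subtype.ext (Subshift.eq_of_equivariant_of_apply_zero (Φ.symm.trans Φ')
    (fun y => ?_) (fun y => ?_) fun y => ?_)
  all_goals obtain ⟨x, rfl⟩ := Φ.surjective y
  · rw [← h₁]
    simp [h₁']
  · rw [← h₂]
    simp [h₂']
  · rw [← h₀]
    simp [h₀']

/-! ### Nonsmoothness -/

theorem orbitClosure_config_mem_NAToepSubsh (p : ℕ → ZMod 2) :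
    orbitClosure (config p) ∈ NAToepSubsh 36 :=
  ⟨isToeplitzSubshift_orbitClosure_config p, isFreeSubshift_orbitClosure_config p,
    not_isAmenableGroup_topologicalFullGroup_config p⟩

/-- The elements that preserve the continuous orbit equivalence class for every parameter are
dense. -/
theorem dense_contOrbitEquiv_config_add : Dense {g : ℕ → ZMod 2 | ∀ p,
    ContOrbitEquiv (ℤ × ℤ) (orbitClosure (config p)).carrier (ℤ × ℤ)
      (orbitClosure (config (g + p))).carrier} := by
  intro g
  -- The truncations of g converge to g, and each is a finite sum of changes at one level.
  refine mem_closure_of_tendsto (f := fun n k => if k < n then g k else 0) (b := Filter.atTop)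
    (tendsto_pi_nhds.2 fun k => tendsto_const_nhds.congr' ?_) (.of_forall fun n p => ?_)
  · filter_upwards [Filter.eventually_gt_atTop k] with n hn
    rw [if_pos hn]
  · induction n with
    | zero =>
      rw [show (fun k => if k < 0 then g k else 0) + p = p by funext k; simp]
      exact .refl'
    | succ n ih =>
      have h : ∀ (q : ℕ → ZMod 2) (a : ZMod 2),
          ContOrbitEquiv (ℤ × ℤ) (orbitClosure (config q)).carrier (ℤ × ℤ)
            (orbitClosure (config (q + Pi.single n a))).carrier := fun q a => by
        obtain rfl | rfl : a = 0 ∨ a = 1 := by revert a; decide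
        · rw [Pi.single_zero, add_zero]
          exact .refl'
        · exact contOrbitEquiv_config_add_single q n
      have he : (fun k => if k < n + 1 then g k else 0) + p =
          (fun k => if k < n then g k else 0) + p + Pi.single n (g n) := by
        rw [add_right_comm]
        congr 1
        funext k
        rcases lt_trichotomy k n with hk | rfl | hk
        · simp [hk, hk.ne, hk.le]
        · simp
        · simp [hk.ne', hk.not_gt, hk.not_ge]
      rw [he]
      exact ih.trans' (h _ (g n))

/-- A Borel function on the Cantor group that is invariant under a dense set of translations is
constant on an uncountable set. -/
theorem exists_not_countable_preimage_singleton {Y : Type*} [MeasurableSpace Y]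
    [MeasurableSpace.CountablySeparated Y] {f : (ℕ → ZMod 2) → Y} (hf : Measurable f)
    (hd : Dense {g | ∀ p, f (g + p) = f p}) : ∃ y, ¬ (f ⁻¹' {y}).Countable := by
  let μ : MeasureTheory.Measure (ℕ → ZMod 2) := MeasureTheory.Measure.addHaar
  have : Nonempty Y := ⟨f 0⟩
  obtain ⟨y, hy⟩ := Filter.exists_eventuallyEq_const_of_forall_separating (l := MeasureTheory.ae μ)
    (f := f) MeasurableSet fun U hU => by
      -- Translations by a dense set act ergodically for Haar measure, so each preimage is null or
      -- conull.
      have := aeconst_of_dense_setOfPred_preimage_vadd_eq (M := ℕ → ZMod 2) (μ := μ)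
        (s := f ⁻¹' U) (hf hU).nullMeasurableSet (hd.mono fun g hg => by
          ext p
          change f (g + p) ∈ U ↔ f p ∈ U
          rw [show f (g + p) = f p from hg p])
      exact Filter.eventuallyConst_set.1 this
  -- The group is not discrete, so Haar measure has no atoms and countable sets are null.
  have : (𝓝[≠] (0 : ℕ → ZMod 2)).NeBot := by
    refine mem_closure_iff_nhdsWithin_neBot.1 (mem_closure_of_tendsto
      (f := fun n : ℕ => (Pi.single n 1 : ℕ → ZMod 2)) (b := Filter.atTop)
      (tendsto_pi_nhds.2 fun k => tendsto_const_nhds.congr' ?_) (.of_forall fun n h => ?_))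
    · filter_upwards [Filter.eventually_gt_atTop k] with n hn
      rw [Pi.single_eq_of_ne hn.ne, Pi.zero_apply]
    · simpa using congrFun (mem_singleton_iff.1 h) n
  refine ⟨y, fun hc => ?_⟩
  have h0 : μ (f ⁻¹' {y}) = 0 := hc.measure_zero μ
  have h1 : μ (f ⁻¹' {y})ᶜ = 0 := hy
  have := MeasureTheory.measure_union_null h0 h1
  rw [union_compl_self, MeasureTheory.Measure.measure_univ_eq_zero] at this
  exact NeZero.ne μ this

theorem mainTheorem11 : ¬ IsSmoothEquivRel (coeSetoid 36) := by
  rintro ⟨Y, _, _, φ, hφ, h⟩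
  let f : (ℕ → ZMod 2) → Y :=
    fun p => φ ⟨orbitClosure (config p), orbitClosure_config_mem_NAToepSubsh p⟩
  have hiff : ∀ p q, f p = f q ↔ ContOrbitEquiv (ℤ × ℤ) (orbitClosure (config p)).carrier (ℤ × ℤ)
      (orbitClosure (config q)).carrier := fun p q => (h _ _).symm
  have hf : Measurable f := by
      exact hφ.comp (continuous_orbitClosure_config.measurable.subtype_mk)
  obtain ⟨y, hy⟩ := exists_not_countable_preimage_singleton hf
    (dense_contOrbitEquiv_config_add.mono fun g hg => by
      rw [mem_ofPred_eq] at hg ⊢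
      exact fun p => ((hiff _ _).2 (hg p)).symm)
  refine hy ?_
  rcases (f ⁻¹' {y}).eq_empty_or_nonempty with he | ⟨p, rfl⟩
  · rw [he]
    exact countable_empty
  · refine ((countable_contOrbitEquiv (orbitClosure (config p))).preimage
      injective_orbitClosure_config).mono fun q hq => ?_
    exact (hiff p q).1 hq.symm
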